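/- A ribbon graph $G$ is a (possibly non-orientable) surface with boundary, presented as the union of a finite set of vertex discs and a finite set $E(G)$ of edge discs (ribbons), where vertices and edges meet in disjoint line segments, each lying on the boundary of exactly one vertex and one edge, and each edge contains exactly two of them; $v(G)$ is the number of vertices. For $A\subseteq E(G)$, the partial dual $G^{\delta(A)}$ is obtained by gluing a disc to $G$ along each boundary component of the spanning ribbon subgraph $(V(G),A)$ (these discs are the new vertices), removing the interiors of the old vertex discs and keeping the ribbons; the partial Petrial $G^{\tau(A)}$ is obtained by adding a half-twist to each edge in $A$. For a word $w=w_1\cdots w_n$ in $\delta,\tau$ put $G^{w(A)}=(\cdots(G^{w_n(A)})\cdots)^{w_1(A)}$, let $G^{1(A)}=G$, and put $G^{\xi(A)\pi(B)}=(G^{\xi(A)})^{\pi(B)}$. The vertex polynomials of $G$ are $$P_{\langle\xi\rangle}(G,x)=\sum_{A\subseteq E(G)}x^{v(G^{\xi(A)})}\quad(\xi\in\{\delta,\tau\delta\tau\}),\qquad P_{\langle\delta\tau\rangle}(G,x)=\sum_{(A_1,A_2,A_3)}x^{v(G^{1(A_1)\,\tau\delta(A_2)\,\delta\tau(A_3)})},$$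 $$P_{\langle\delta,\tau\rangle}(G,x)=\sum_{(A_1,\dots,A_6)}x^{v(G^{1(A_1)\,\delta(A_2)\,\tau(A_3)\,\tau\delta(A_4)\,\delta\tau(A_5)\,\tau\delta\tau(A_6)})},$$ the last two sums running over all ordered partitions of $E(G)$ into $3$, respectively $6$, pairwise disjoint, possibly empty sets. A bouquet is a ribbon graph with exactly one vertex. An edge of a bouquet is a non-orientable loop if its ribbon together with the vertex forms a Möbius band, and an orientable loop otherwise; two edges are interlaced if their half-edges alternate in the cyclic order around the vertex. The signed intersection graph $SI(B)$ of a bouquet $B$ has vertex set $E(B)$; two vertices are adjacent if and only if they are interlaced in $B$, and a vertex has sign $+$ if it is an orientable loop and sign $-$ if it is a non-orientable loop. Theorem. If $B_1$ and $B_2$ are bouquets and there is a graph isomorphism $SI(B_1)\cong SI(B_2)$ preserving signs, then $$P_{\bullet}(B_1,x)=P_{\bullet}(B_2,x)\quad\text{for every }\bullet\in\{\langle\delta\rangle,\langle\delta\tau\rangle,\langle\tau\delta\tau\rangle,\langle\delta,\tau\rangle\}.$$ -/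

import Mathlib

open Polynomial

/-- A (finite, when `E` is finite) ribbon graph with edge set `E`, presented by the corners of its
edge discs. Every edge is a rectangular disc: two opposite sides are the line segments in which it
meets the vertex discs, the two other sides are its free sides, and it has four corners. `C` is the
set of all corners of all edges.
* `edge c` is the edge having the corner `c`;
* `seg c` is the other end of the common line segment of edge and vertex that ends at `c`;
* `side c` is the other end of the free side of the edge that ends at `c`;
* `arc c` is the other end of the arc of a vertex boundary that starts at `c` and runs between two
  consecutive line segments.
The boundary circle of a vertex disc that meets an edge is an alternating cycle of line segments and
arcs; `isolated` is the number of vertex discs that meet no edge. -/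
structure RibbonGraph (E C : Type*) where
  edge : C → E
  seg : C → C
  side : C → C
  arc : C → C
  isolated : ℕ
  edge_surjective : Function.Surjective edge
  seg_involutive : Function.Involutive seg
  side_involutive : Function.Involutive side
  arc_involutive : Function.Involutive arc
  seg_ne : ∀ c, seg c ≠ c
  side_ne : ∀ c, side c ≠ c
  arc_ne : ∀ c, arc c ≠ c
  seg_ne_side : ∀ c, seg c ≠ side c
  seg_side_comm : ∀ c, seg (side c) = side (seg c)
  edge_eq_iff : ∀ c d, edge c = edge d ↔ d = c ∨ d = seg c ∨ d = side c ∨ d = seg (side c)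

/-- The two generating operations: `delta` is partial duality, `tau` is the half-twist. -/
inductive RibbonOp where
  | delta
  | tau

namespace RibbonGraph

variable {E C : Type*}

theorem edge_seg (G : RibbonGraph E C) (c : C) : G.edge (G.seg c) = G.edge c :=
  ((G.edge_eq_iff c (G.seg c)).2 (Or.inr (Or.inl rfl))).symm

theorem edge_side (G : RibbonGraph E C) (c : C) : G.edge (G.side c) = G.edge c :=
  ((G.edge_eq_iff c (G.side c)).2 (Or.inr (Or.inr (Or.inl rfl)))).symm

theorem edge_seg_side (G : RibbonGraph E C) (c : C) : G.edge (G.seg (G.side c)) = G.edge c := by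
  rw [G.edge_seg, G.edge_side]

/-- The number of vertices: the closed curves made of line segments and arcs, and the isolated
vertices. (`Quot` passes to the equivalence relation generated by the given relation.) -/
noncomputable def vertexCount (G : RibbonGraph E C) : ℕ :=
  Nat.card (Quot fun c d : C => d = G.seg c ∨ d = G.arc c) + G.isolated

/-- A bouquet is a ribbon graph with exactly one vertex. -/
def IsBouquet (G : RibbonGraph E C) : Prop := G.vertexCount = 1

open Classical in
/-- The partial dual with respect to `A`. The boundary components of the spanning ribbon subgraph
`(V, A)` run along the arcs, along the free sides of the edges in `A`, and along the line segments
left behind by the deleted edges. Discs glued to these components become the new vertices, and the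
edge discs and all arcs are kept. So an edge in `A` now meets the vertices in its former free sides,
and its former line segments become free. -/
noncomputable def partialDual (G : RibbonGraph E C) (A : Set E) : RibbonGraph E C where
  edge := G.edge
  seg c := if G.edge c ∈ A then G.side c else G.seg c
  side c := if G.edge c ∈ A then G.seg c else G.side c
  arc := G.arc
  isolated := G.isolated
  edge_surjective := G.edge_surjective
  seg_involutive c := by
    by_cases h : G.edge c ∈ A
    · simp [h, G.edge_side, G.side_involutive c]
    · simp [h, G.edge_seg, G.seg_involutive c]
  side_involutive c := by
    by_cases h : G.edge c ∈ A
    · simp [h, G.edge_seg, G.seg_involutive c]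
    · simp [h, G.edge_side, G.side_involutive c]
  arc_involutive := G.arc_involutive
  seg_ne c := by
    by_cases h : G.edge c ∈ A
    · simpa [h] using G.side_ne c
    · simpa [h] using G.seg_ne c
  side_ne c := by
    by_cases h : G.edge c ∈ A
    · simpa [h] using G.seg_ne c
    · simpa [h] using G.side_ne c
  arc_ne := G.arc_ne
  seg_ne_side c := by
    by_cases h : G.edge c ∈ A
    · simpa [h] using (G.seg_ne_side c).symm
    · simpa [h] using G.seg_ne_side c
  seg_side_comm c := by
    by_cases h : G.edge c ∈ A
    · simp [h, G.edge_seg, G.edge_side, G.seg_side_comm c]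
    · simp [h, G.edge_seg, G.edge_side, G.seg_side_comm c]
  edge_eq_iff c d := by
    by_cases h : G.edge c ∈ A
    · simp only [h, G.edge_seg, if_true, ← G.seg_side_comm c, G.edge_eq_iff c d]
      tauto
    · simp only [h, G.edge_side, if_false, G.edge_eq_iff c d]

open Classical in
/-- The partial Petrial with respect to `A`: a half-twist is added to each edge in `A`, so that the
free sides of such an edge now join the opposite corners. -/
noncomputable def partialPetrial (G : RibbonGraph E C) (A : Set E) : RibbonGraph E C where
  edge := G.edge
  seg := G.seg
  side c := if G.edge c ∈ A then G.seg (G.side c) else G.side c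
  arc := G.arc
  isolated := G.isolated
  edge_surjective := G.edge_surjective
  seg_involutive := G.seg_involutive
  side_involutive c := by
    by_cases h : G.edge c ∈ A
    · simp [h, G.edge_seg_side, ← G.seg_side_comm, G.side_involutive c, G.seg_involutive c]
    · simp [h, G.edge_side, G.side_involutive c]
  arc_involutive := G.arc_involutive
  seg_ne := G.seg_ne
  side_ne c := by
    by_cases h : G.edge c ∈ A
    · simp only [h, if_true]
      intro h'
      exact G.seg_ne_side c (by rw [← G.seg_involutive (G.side c), h'])
    · simpa [h] using G.side_ne c
  arc_ne := G.arc_ne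
  seg_ne_side c := by
    by_cases h : G.edge c ∈ A
    · simp only [h, if_true]
      intro h'
      exact G.side_ne c (G.seg_involutive.injective h').symm
    · simpa [h] using G.seg_ne_side c
  seg_side_comm c := by
    by_cases h : G.edge c ∈ A
    · simp [h, G.edge_seg, G.seg_side_comm c]
    · simp [h, G.edge_seg, G.seg_side_comm c]
  edge_eq_iff c d := by
    by_cases h : G.edge c ∈ A
    · simp only [h, if_true, G.seg_involutive (G.side c), G.edge_eq_iff c d]
      tauto
    · simp only [h, if_false, G.edge_eq_iff c d]

/-- A single operation applied to an edge set. -/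
noncomputable def applyOp (G : RibbonGraph E C) (A : Set E) : RibbonOp → RibbonGraph E C
  | .delta => G.partialDual A
  | .tau => G.partialPetrial A

/-- `G.act w A` is `G^{w(A)}` for a word `w = w₁ w₂ ⋯ wₙ`; the last letter is applied first. -/
noncomputable def act (G : RibbonGraph E C) (w : List RibbonOp) (A : Set E) : RibbonGraph E C :=
  w.foldr (fun o H => H.applyOp A o) G

open RibbonOp

/-- `P_⟨δ⟩(G, x) = ∑_{A ⊆ E} x^{v(G^{δ(A)})}`. -/
noncomputable def vertexPolyDelta [Fintype E] (G : RibbonGraph E C) : ℤ[X] :=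
  ∑ A : Finset E, X ^ (G.act [delta] (A : Set E)).vertexCount

/-- `P_⟨τδτ⟩(G, x) = ∑_{A ⊆ E} x^{v(G^{τδτ(A)})}`. -/
noncomputable def vertexPolyTauDeltaTau [Fintype E] (G : RibbonGraph E C) : ℤ[X] :=
  ∑ A : Finset E, X ^ (G.act [tau, delta, tau] (A : Set E)).vertexCount

/-- `P_⟨δτ⟩(G, x)`: the sum of `x^{v(H)}`, `H = G^{1(A₁) τδ(A₂) δτ(A₃)}`, over all ordered partitions
of the edge set into three (possibly empty) blocks. Such a partition is given by the map `p` sending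
an edge to the index of its block. -/
noncomputable def vertexPolyDeltaTau [Fintype E] [DecidableEq E] (G : RibbonGraph E C) : ℤ[X] :=
  ∑ p : E → Fin 3,
    X ^ (((G.act [] (p ⁻¹' {0})).act [tau, delta] (p ⁻¹' {1})).act
      [delta, tau] (p ⁻¹' {2})).vertexCount

/-- `P_⟨δ,τ⟩(G, x)`: the sum of `x^{v(H)}`,
`H = G^{1(A₁) δ(A₂) τ(A₃) τδ(A₄) δτ(A₅) τδτ(A₆)}`, over all ordered partitions of the edge set into
six (possibly empty) blocks. -/
noncomputable def vertexPolyFull [Fintype E] [DecidableEq E] (G : RibbonGraph E C) : ℤ[X] :=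
  ∑ p : E → Fin 6,
    X ^ ((((((G.act [] (p ⁻¹' {0})).act [delta] (p ⁻¹' {1})).act [tau] (p ⁻¹' {2})).act
      [tau, delta] (p ⁻¹' {3})).act [delta, tau] (p ⁻¹' {4})).act
      [tau, delta, tau] (p ⁻¹' {5})).vertexCount

/-- The loop `e` is orientable: the surface formed by the vertex discs and the ribbon `e` is
orientable, that is, the corners can be labelled by the two directions of travel in such a way that
the two ends of each boundary piece of the vertex discs, and of each free side of `e`, get opposite
labels. Otherwise `e` and its vertex form a Möbius band. -/
def IsOrientableLoop (G : RibbonGraph E C) (e : E) : Prop :=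
  ∃ o : C → Bool, (∀ c, o (G.seg c) = !o c) ∧ (∀ c, o (G.arc c) = !o c) ∧
    ∀ c, G.edge c = e → o (G.side c) = !o c

/-- One step round the boundary of a vertex: run along a line segment and then along the next arc,
which leads to the beginning of the next line segment. The orbit of a corner lists the half-edges of
its vertex, each one once, in their cyclic order. -/
def next (G : RibbonGraph E C) (c : C) : C := G.arc (G.seg c)

/-- The half-edges of `e` and `f` alternate in the cyclic order round the vertex: during one single
turn one meets `e`, `f`, `e`, `f` in this order. -/
def Interlaced (G : RibbonGraph E C) (e f : E) : Prop :=
  ∃ (c : C) (i j k : ℕ), 0 < i ∧ i < j ∧ j < k ∧ k < Function.minimalPeriod G.next c ∧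
    G.edge c = e ∧ G.edge (G.next^[i] c) = f ∧ G.edge (G.next^[j] c) = e ∧
    G.edge (G.next^[k] c) = f

theorem Interlaced.symm {G : RibbonGraph E C} {e f : E} (h : G.Interlaced e f) :
    G.Interlaced f e := by
  obtain ⟨c, i, j, k, hi, hij, hjk, hk, h0, h1, h2, h3⟩ := h
  have hc : c ∈ Function.periodicPts G.next :=
    Function.minimalPeriod_pos_iff_mem_periodicPts.1 (by omega)
  refine ⟨G.next^[i] c, j - i, k - i, Function.minimalPeriod G.next c - i, by omega, by omega,
    by omega, ?_, h1, ?_, ?_, ?_⟩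
  · rw [Function.minimalPeriod_apply_iterate hc]; omega
  · rw [← Function.iterate_add_apply, Nat.sub_add_cancel hij.le, h2]
  · rw [← Function.iterate_add_apply, Nat.sub_add_cancel (hij.trans hjk).le, h3]
  · rw [← Function.iterate_add_apply, Nat.sub_add_cancel (by omega),
      Function.iterate_minimalPeriod, h0]

/-- The intersection graph of a bouquet. -/
def intersectionGraph (G : RibbonGraph E C) : SimpleGraph E where
  Adj e f := e ≠ f ∧ G.Interlaced e f
  symm := ⟨fun _ _ h => ⟨h.1.symm, h.2.symm⟩⟩
  loopless := ⟨fun _ h => h.1 rfl⟩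

end RibbonGraph

/-- A simple graph with a sign at each vertex. -/
structure SignedGraph (V : Type*) where
  graph : SimpleGraph V
  sign : V → ℤˣ

/-- Isomorphism of signed graphs: a graph isomorphism that preserves the signs. -/
def SignedGraph.IsIsomorphic {V W : Type*} (S : SignedGraph V) (T : SignedGraph W) : Prop :=
  ∃ φ : S.graph ≃g T.graph, ∀ v, T.sign (φ v) = S.sign v

open Classical in
/-- The signed intersection graph of a bouquet: the intersection graph with the sign `+` at the
orientable loops and `-` at the non-orientable loops. -/
noncomputable def RibbonGraph.signedIntersectionGraph {E C : Type*} (B : RibbonGraph E C) :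
    SignedGraph E where
  graph := B.intersectionGraph
  sign e := if B.IsOrientableLoop e then 1 else -1

/-! ### Corners and the direction of travel round a vertex -/

namespace RibbonGraph

variable {E C : Type*}

/-! All twisted duals `H` of a bouquet `G` share its corners and arcs; they differ only in which of
three pairings of the corners of each edge is the line-segment pairing (`IsRepairing`). So it
suffices to compute the vertex count from the choice `t` of pairings and the signed intersection
graph.

When there are edges, `2 ^ v(H)` counts the `ZMod 2`-valued functions on corners invariant under
arcs and segments of `H` (`card_boundaryFunctions`). Such a function jumps by a constant `x e` along
both `G`-segments of `e`, so it is a potential of some `x`. As `G` has one vertex, every `x` has a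
potential, unique up to a constant: one turn meets each edge twice, so the jumps cancel. Along a
free side of `e` the potential changes by `(M x) e`, where `M` is the adjacency matrix of the
intersection graph with diagonal `1` at non-orientable loops (`single_side_eq_iff`,
`single_side_ne_iff`). Invariance under `H` is thus one equation per edge: `x e = 0`, `(M x) e = 0`
or `(M x) e + x e = 0`. Hence `2 ^ v(H)` is twice the number of solutions (`two_pow_vertexCount`),
which a sign-preserving isomorphism respects; it also matches the summands of the polynomials. -/

theorem finite_corners [Finite E] (G : RibbonGraph E C) : Finite C := by
  choose r hr using G.edge_surjective
  refine Finite.of_surjective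
    (fun p : E × Fin 4 => ![r p.1, G.seg (r p.1), G.side (r p.1), G.seg (G.side (r p.1))] p.2) ?_
  intro c
  rcases (G.edge_eq_iff (r (G.edge c)) c).1 (hr _) with h | h | h | h
  · exact ⟨(G.edge c, 0), h.symm⟩
  · exact ⟨(G.edge c, 1), h.symm⟩
  · exact ⟨(G.edge c, 2), h.symm⟩
  · exact ⟨(G.edge c, 3), h.symm⟩

theorem next_injective (G : RibbonGraph E C) : Function.Injective G.next :=
  G.arc_involutive.injective.comp G.seg_involutive.injective

theorem arc_next (G : RibbonGraph E C) (c : C) : G.arc (G.next c) = G.seg c :=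
  G.arc_involutive _

theorem next_seg_next (G : RibbonGraph E C) (c : C) : G.next (G.seg (G.next c)) = G.seg c := by
  rw [next, G.seg_involutive, G.arc_next]

/-- Going round a vertex never reverses the direction of travel. -/
theorem iterate_next_ne_seg (G : RibbonGraph E C) (n : ℕ) (c : C) : G.next^[n] c ≠ G.seg c := by
  induction n using Nat.twoStepInduction generalizing c with
  | zero => exact (G.seg_ne c).symm
  | one => exact G.arc_ne (G.seg c)
  | more n ih _ =>
    intro h
    -- `seg` conjugates `next` to its inverse, so a walk from `c` to `seg c` can be shortened by one
    -- step at each end.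
    apply ih (G.next c)
    apply G.next_injective
    rw [← Function.iterate_succ_apply' G.next n, ← Function.iterate_succ_apply, h, G.next_seg_next]

theorem iterate_next_ne_seg_iterate (G : RibbonGraph E C) (i j : ℕ) (c : C) :
    G.next^[i] c ≠ G.seg (G.next^[j] c) := by
  intro h
  rcases le_total j i with hij | hij
  · rw [← Nat.sub_add_cancel hij, Function.iterate_add_apply] at h
    exact G.iterate_next_ne_seg _ _ h
  · have h' : G.next^[j] c = G.seg (G.next^[i] c) := by rw [h, G.seg_involutive]
    rw [← Nat.sub_add_cancel hij, Function.iterate_add_apply] at h'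
    exact G.iterate_next_ne_seg _ _ h'

/-- All corners lie on the boundary of the same vertex. -/
def IsConnectedBoundary (G : RibbonGraph E C) : Prop :=
  Subsingleton (Quot fun c d : C => d = G.seg c ∨ d = G.arc c)

/-- Since `seg` and `arc` are involutions, closure under them makes `P` descend to the quotient,
which has at most one point. -/
theorem IsConnectedBoundary.induction {G : RibbonGraph E C} (hG : G.IsConnectedBoundary)
    {P : C → Prop} (hs : ∀ c, P c → P (G.seg c)) (ha : ∀ c, P c → P (G.arc c)) {c : C} (hc : P c)
    (d : C) : P d := by
  have key : ∀ a b : C, (b = G.seg a ∨ b = G.arc a) → P a = P b := by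
    rintro a b (rfl | rfl)
    · exact propext ⟨hs a, fun h => by simpa [G.seg_involutive a] using hs _ h⟩
    · exact propext ⟨ha a, fun h => by simpa [G.arc_involutive a] using ha _ h⟩
  have h := congrArg (Quot.lift P key) (hG.allEq (Quot.mk _ c) (Quot.mk _ d))
  exact h.mp hc

/-! ### One turn round the single vertex -/

section Walk

variable {G : RibbonGraph E C}

theorem minimalPeriod_next_pos [Finite E] (G : RibbonGraph E C) (c : C) :
    0 < Function.minimalPeriod G.next c :=
  haveI := G.finite_corners
  Function.minimalPeriod_pos_of_mem_periodicPts (G.next_injective.mem_periodicPts c)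

theorem iterate_next_mod (G : RibbonGraph E C) (c : C) (n : ℕ) :
    G.next^[n % Function.minimalPeriod G.next c] c = G.next^[n] c :=
  Function.iterate_mod_minimalPeriod_eq

theorem IsConnectedBoundary.exists_iterate_next [Finite E] (hG : G.IsConnectedBoundary) (c d : C) :
    ∃ i < Function.minimalPeriod G.next c, d = G.next^[i] c ∨ d = G.seg (G.next^[i] c) := by
  have hpos := G.minimalPeriod_next_pos c
  suffices h : ∃ i, d = G.next^[i] c ∨ d = G.seg (G.next^[i] c) by
    obtain ⟨i, hi⟩ := h
    exact ⟨i % _, Nat.mod_lt _ hpos, by rwa [G.iterate_next_mod]⟩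
  refine hG.induction (P := fun d => ∃ i, d = G.next^[i] c ∨ d = G.seg (G.next^[i] c)) ?_ ?_
    (c := c) ⟨0, Or.inl rfl⟩ d
  · rintro d ⟨i, rfl | rfl⟩
    · exact ⟨i, Or.inr rfl⟩
    · exact ⟨i, Or.inl (G.seg_involutive _)⟩
  · rintro d ⟨i, rfl | rfl⟩
    · cases i with
      | zero =>
        -- The arc at the starting corner leads back to the last half-edge of the turn.
        refine ⟨Function.minimalPeriod G.next c - 1, Or.inr ?_⟩
        rw [← G.arc_next, ← Function.iterate_succ_apply' G.next, Nat.succ_eq_add_one,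
          Nat.sub_add_cancel hpos, Function.iterate_minimalPeriod]
        rfl
      | succ i => exact ⟨i, Or.inr (by rw [Function.iterate_succ_apply', G.arc_next])⟩
    · exact ⟨i + 1, Or.inl (by rw [Function.iterate_succ_apply']; rfl)⟩

theorem iterate_next_unique {c : C} {i j : ℕ} (hi : i < Function.minimalPeriod G.next c)
    (hj : j < Function.minimalPeriod G.next c)
    (h : G.next^[i] c = G.next^[j] c ∨ G.next^[i] c = G.seg (G.next^[j] c)) : i = j := by
  rcases h with h | h
  · exact Function.iterate_injOn_Iio_minimalPeriod hi hj h
  · exact absurd h (G.iterate_next_ne_seg_iterate i j c)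

/-- An edge has only two line segments, and one turn runs along each at most once. -/
theorem edge_iterate_next_eq_or {c : C} {i j m : ℕ} (hi : i < Function.minimalPeriod G.next c)
    (hj : j < Function.minimalPeriod G.next c) (hm : m < Function.minimalPeriod G.next c)
    (hij : i ≠ j) (h : G.edge (G.next^[i] c) = G.edge (G.next^[j] c))
    (h' : G.edge (G.next^[i] c) = G.edge (G.next^[m] c)) : m = i ∨ m = j := by
  by_contra! hne
  have aux : ∀ k, k < Function.minimalPeriod G.next c → k ≠ i →
      G.edge (G.next^[i] c) = G.edge (G.next^[k] c) →
      G.next^[k] c = G.side (G.next^[i] c) ∨ G.next^[k] c = G.seg (G.side (G.next^[i] c)) := by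
    intro k hk hki he
    rcases (G.edge_eq_iff _ _).1 he with h | h | h | h
    · exact absurd (iterate_next_unique hk hi (Or.inl h)) hki
    · exact absurd (iterate_next_unique hk hi (Or.inr h)) hki
    · exact Or.inl h
    · exact Or.inr h
  have h1 := aux j hj hij.symm h
  have h2 := aux m hm hne.1 h'
  apply hne.2
  apply iterate_next_unique hm hj
  rcases h1 with h1 | h1 <;> rcases h2 with h2 | h2 <;> simp [h1, h2, G.seg_involutive _]

/-- The other half-edge of the edge at which a walk is. -/
theorem IsConnectedBoundary.exists_other_end [Finite E] (hG : G.IsConnectedBoundary) {c : C} {i : ℕ}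
    (hi : i < Function.minimalPeriod G.next c) :
    ∃ j < Function.minimalPeriod G.next c, j ≠ i ∧
      (G.next^[j] c = G.side (G.next^[i] c) ∨ G.next^[j] c = G.seg (G.side (G.next^[i] c))) := by
  obtain ⟨j, hj, h⟩ := hG.exists_iterate_next c (G.side (G.next^[i] c))
  refine ⟨j, hj, ?_, ?_⟩
  · rintro rfl
    rcases h with h | h
    · exact G.side_ne _ h
    · exact G.seg_ne_side _ h.symm
  · rcases h with h | h
    · exact Or.inl h.symm
    · right; rw [h, G.seg_involutive]

end Walk

/-! ### Potentials, orientability and interlacement -/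

/-- `h` is constant along the arcs and jumps by `x e` along the line segments of `e`. -/
def IsPotential (G : RibbonGraph E C) (x : E → ZMod 2) (h : C → ZMod 2) : Prop :=
  (∀ c, h (G.arc c) = h c) ∧ ∀ c, h (G.seg c) = h c + x (G.edge c)

section Potential

variable {G : RibbonGraph E C}

theorem IsPotential.iterate_next {x : E → ZMod 2} {h : C → ZMod 2} (hh : G.IsPotential x h) (c : C)
    (n : ℕ) : h (G.next^[n] c) = h c + ∑ m ∈ Finset.range n, x (G.edge (G.next^[m] c)) := by
  induction n with
  | zero => simp
  | succ n ih =>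
    rw [Function.iterate_succ_apply', next, hh.1, hh.2, ih, Finset.sum_range_succ, add_assoc]

/-- The jumps cancel in `h + k`, so it is constant on the connected boundary: a potential is unique
up to a constant. -/
theorem IsPotential.eq_of_eq (hG : G.IsConnectedBoundary) {x : E → ZMod 2} {h k : C → ZMod 2}
    (hh : G.IsPotential x h) (hk : G.IsPotential x k) (c d : C) :
    h d + k d = h c + k c := by
  refine hG.induction (P := fun d => h d + k d = h c + k c) ?_ ?_ (c := c) rfl d
  · intro a ha
    rw [hh.2, hk.2, ← ha]
    linear_combination CharTwo.add_self_eq_zero (x (G.edge a))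
  · intro a ha
    rw [hh.1, hk.1, ha]

theorem IsPotential.sum {ι : Type*} (s : Finset ι) {x : ι → E → ZMod 2} {h : ι → C → ZMod 2}
    (a : ι → ZMod 2) (hh : ∀ i, G.IsPotential (x i) (h i)) :
    G.IsPotential (fun e => ∑ i ∈ s, a i * x i e) (fun c => ∑ i ∈ s, a i * h i c) := by
  refine ⟨fun c => ?_, fun c => ?_⟩
  · simp only [(hh _).1]
  · simp only [(hh _).2, mul_add, Finset.sum_add_distrib]

theorem sum_single_edge [DecidableEq E] (G : RibbonGraph E C) (e : E) (c : C) (s : Finset ℕ) :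
    ∑ m ∈ s, (Pi.single e 1 : E → ZMod 2) (G.edge (G.next^[m] c)) =
      ((s.filter fun m => G.edge (G.next^[m] c) = e).card : ZMod 2) := by
  simp [Pi.single_apply, Finset.sum_boole]

theorem IsConnectedBoundary.sum_single_period [Finite E] [DecidableEq E]
    (hG : G.IsConnectedBoundary) (e : E) (c : C) :
    ∑ m ∈ Finset.range (Function.minimalPeriod G.next c),
      (Pi.single e 1 : E → ZMod 2) (G.edge (G.next^[m] c)) = 0 := by
  obtain ⟨d, rfl⟩ := G.edge_surjective e
  obtain ⟨i, hi, hd⟩ := hG.exists_iterate_next c d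
  have hde : G.edge d = G.edge (G.next^[i] c) := by
    rcases hd with h | h <;> rw [h]
    rw [G.edge_seg]
  obtain ⟨j, hj, hji, h⟩ := hG.exists_other_end hi
  have hj' : G.edge (G.next^[i] c) = G.edge (G.next^[j] c) := by
    rcases h with h | h <;> rw [h]
    · rw [G.edge_side]
    · rw [G.edge_seg_side]
  rw [sum_single_edge, show Finset.filter _ _ = {i, j} from ?_, Finset.card_pair hji.symm]
  · rfl
  · ext m
    simp only [Finset.mem_filter, Finset.mem_range, Finset.mem_insert, Finset.mem_singleton]
    constructor
    · rintro ⟨hm, he⟩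
      exact edge_iterate_next_eq_or hi hj hm hji.symm hj' (by rw [he, hde])
    · rintro (rfl | rfl)
      · exact ⟨hi, hde.symm⟩
      · exact ⟨hj, by rw [hde, hj']⟩

/-- Integrate the jumps along one turn; the total is zero by `sum_single_period`, so the result
closes up. -/
theorem IsConnectedBoundary.exists_potential_single [Finite E] [DecidableEq E]
    (hG : G.IsConnectedBoundary) (e : E) : ∃ h, G.IsPotential (Pi.single e 1) h := by
  obtain ⟨c, -⟩ := G.edge_surjective e
  set N := Function.minimalPeriod G.next c with hN
  set S : ℕ → ZMod 2 := fun n =>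
    ∑ m ∈ Finset.range n, (Pi.single e 1 : E → ZMod 2) (G.edge (G.next^[m] c)) with hS
  have hSN : S N = 0 := hG.sum_single_period e c
  have hSs : ∀ n, S (n + 1) = S n + (Pi.single e 1 : E → ZMod 2) (G.edge (G.next^[n] c)) :=
    fun n => Finset.sum_range_succ _ _
  choose i hi hd using hG.exists_iterate_next c
  classical
  -- The corner at which the walk enters a segment gets the sum before crossing it, the other end
  -- the sum after.
  let h : C → ZMod 2 := fun d => if d = G.next^[i d] c then S (i d) else S (i d + 1)
  have h1 : ∀ n < N, h (G.next^[n] c) = S n := by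
    intro n hn
    have hin : i (G.next^[n] c) = n := (iterate_next_unique hn (hi _) (hd _)).symm
    simp only [h, hin, if_true]
  have h2 : ∀ n < N, h (G.seg (G.next^[n] c)) = S (n + 1) := by
    intro n hn
    have hin : i (G.seg (G.next^[n] c)) = n := by
      symm
      apply iterate_next_unique hn (hi _)
      rcases hd (G.seg (G.next^[n] c)) with h | h
      · exact absurd h.symm (G.iterate_next_ne_seg_iterate _ _ _)
      · exact Or.inl (G.seg_involutive.injective h)
    simp only [h, hin, if_neg (G.iterate_next_ne_seg_iterate n n c).symm]
  have h3 : ∀ n ≤ N, h (G.next^[n] c) = S n := by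
    intro n hn
    rcases hn.lt_or_eq with hn | rfl
    · exact h1 n hn
    · rw [hN, Function.iterate_minimalPeriod, ← hN, hSN]
      exact h1 0 (G.minimalPeriod_next_pos c)
  have h4 : ∀ n < N, h (G.next^[n + 1] c) = h (G.seg (G.next^[n] c)) := by
    intro n hn
    rw [h3 _ hn, h2 _ hn]
  refine ⟨h, fun d => ?_, fun d => ?_⟩
  · rcases hd d with hd' | hd'
    · obtain ⟨n, hn, hdn⟩ : ∃ n < N, d = G.next^[n + 1] c := by
        rcases Nat.eq_zero_or_pos (i d) with h0 | h0
        · have hpos := G.minimalPeriod_next_pos c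
          refine ⟨N - 1, by omega, ?_⟩
          rw [Nat.sub_add_cancel hpos, Function.iterate_minimalPeriod, hd', h0]
          rfl
        · refine ⟨i d - 1, by have := hi d; omega, ?_⟩
          rwa [Nat.sub_add_cancel h0]
      rw [hdn, h4 n hn, Function.iterate_succ_apply', G.arc_next]
    · rw [hd', ← h4 _ (hi d), Function.iterate_succ_apply']
      rfl
  · rcases hd d with hd' | hd'
    · rw [hd', h2 _ (hi d), h1 _ (hi d), hSs]
    · rw [hd', G.seg_involutive, h2 _ (hi d), h1 _ (hi d), hSs, G.edge_seg, add_assoc,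
        CharTwo.add_self_eq_zero, add_zero]

/-- Label a corner by whether the walk from `c` visits it: exactly one end of each segment is
visited, and never both ends of an arc. -/
theorem IsConnectedBoundary.exists_direction [Finite E] (hG : G.IsConnectedBoundary) (c : C) :
    ∃ o : C → Bool, (∀ d, o (G.seg d) = !o d) ∧ ∀ d, o (G.arc d) = !o d := by
  classical
  have key : ∀ d, (∃ n, G.next^[n] c = G.seg d) ↔ ¬ ∃ n, G.next^[n] c = d := by
    intro d
    constructor
    · rintro ⟨n, hn⟩ ⟨m, rfl⟩
      exact G.iterate_next_ne_seg_iterate _ _ _ hn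
    · intro h
      obtain ⟨n, -, hn | hn⟩ := hG.exists_iterate_next c d
      · exact absurd ⟨n, hn.symm⟩ h
      · exact ⟨n, by rw [hn, G.seg_involutive]⟩
  have hnext : ∀ d, (∃ n, G.next^[n] c = G.next d) ↔ ∃ n, G.next^[n] c = d := by
    intro d
    constructor
    · rintro ⟨n, hn⟩
      cases n with
      | zero =>
        refine ⟨Function.minimalPeriod G.next c - 1, G.next_injective ?_⟩
        rw [← Function.iterate_succ_apply' G.next, Nat.succ_eq_add_one,
          Nat.sub_add_cancel (G.minimalPeriod_next_pos c), Function.iterate_minimalPeriod, ← hn]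
        rfl
      | succ n => exact ⟨n, G.next_injective (by rw [← hn, Function.iterate_succ_apply'])⟩
    · rintro ⟨n, rfl⟩
      exact ⟨n + 1, Function.iterate_succ_apply' _ _ _⟩
  have hseg : ∀ d, decide (∃ n, G.next^[n] c = G.seg d) = !decide (∃ n, G.next^[n] c = d) := by
    intro d
    rw [← decide_not, decide_eq_decide]
    exact key d
  refine ⟨fun d => decide (∃ n, G.next^[n] c = d), hseg, fun d => ?_⟩
  obtain ⟨a, rfl⟩ := G.seg_involutive.surjective d
  change decide (∃ n, G.next^[n] c = G.next a) = !decide (∃ n, G.next^[n] c = G.seg a)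
  rw [hseg, Bool.not_not, decide_eq_decide]
  exact hnext a

/-- The walk from `c` to the other half-edge of its edge crosses that edge once, so `h` changes by
`1`. It arrives either at `side c`, with the same direction as at `c` (non-orientable), or at `seg
(side c)`, one further jump away from `side c` (orientable). -/
theorem IsPotential.single_side_eq_iff [Finite E] [DecidableEq E] (hG : G.IsConnectedBoundary)
    {c : C} {h : C → ZMod 2} (hh : G.IsPotential (Pi.single (G.edge c) 1) h) :
    h (G.side c) = h c ↔ G.IsOrientableLoop (G.edge c) := by
  have hpos := G.minimalPeriod_next_pos c
  obtain ⟨j, hj, hj0, hside⟩ := hG.exists_other_end hpos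
  change G.next^[j] c = G.side c ∨ G.next^[j] c = G.seg (G.side c) at hside
  have hje : G.edge c = G.edge (G.next^[j] c) := by
    rcases hside with h | h <;> rw [h]
    · rw [G.edge_side]
    · rw [G.edge_seg_side]
  have hsum : h (G.next^[j] c) = h c + 1 := by
    rw [hh.iterate_next, sum_single_edge, show Finset.filter _ _ = {0} from ?_,
      Finset.card_singleton, Nat.cast_one]
    ext m
    simp only [Finset.mem_filter, Finset.mem_range, Finset.mem_singleton]
    constructor
    · rintro ⟨hm, he⟩
      have := edge_iterate_next_eq_or (m := m) hpos hj (hm.trans hj) hj0.symm hje he.symm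
      omega
    · rintro rfl
      exact ⟨Nat.pos_of_ne_zero hj0, rfl⟩
  have hdir : ∀ o : C → Bool, (∀ d, o (G.seg d) = !o d) → (∀ d, o (G.arc d) = !o d) →
      o (G.next^[j] c) = o c := by
    intro o hs ha
    clear hj hj0 hside hje hsum
    induction j with
    | zero => rfl
    | succ j ih => rw [Function.iterate_succ_apply', next, ha, hs, Bool.not_not, ih]
  rcases hside with hside | hside
  · rw [hside] at hsum hdir
    refine iff_of_false (by rw [hsum]; simp) ?_
    rintro ⟨o, hs, ha, hsd⟩
    have h1 := hsd c rfl
    rw [hdir o hs ha] at h1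
    simp at h1
  · rw [hside] at hsum hdir
    refine iff_of_true ?_ ?_
    · have h1 := hh.2 (G.side c)
      rw [hsum, G.edge_side, Pi.single_eq_same] at h1
      exact (add_right_cancel h1).symm
    · obtain ⟨o, hs, ha⟩ := hG.exists_direction c
      have h1 : o (G.side c) = !o c := by
        have := hdir o hs ha
        rw [hs] at this
        rw [← this, Bool.not_not]
      refine ⟨o, hs, ha, fun d hd => ?_⟩
      rcases (G.edge_eq_iff c d).1 hd.symm with rfl | rfl | rfl | rfl
      · exact h1
      · rw [← G.seg_side_comm, hs, hs, h1]
      · rw [G.side_involutive, h1, Bool.not_not]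
      · rw [← G.seg_side_comm, G.side_involutive, hs, hs, h1]; simp

theorem IsPotential.side_eq_of_edge_eq {x : E → ZMod 2} {h : C → ZMod 2} (hh : G.IsPotential x h)
    {c d : C} (hcd : G.edge c = G.edge d) : h (G.side c) + h c = h (G.side d) + h d := by
  rcases (G.edge_eq_iff c d).1 hcd with rfl | rfl | rfl | rfl
  · rfl
  · rw [← G.seg_side_comm, hh.2, hh.2, G.edge_side]
    linear_combination -CharTwo.add_self_eq_zero (x (G.edge c))
  · rw [G.side_involutive, add_comm]
  · rw [← G.seg_side_comm, G.side_involutive, hh.2, hh.2, G.edge_side]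
    linear_combination -CharTwo.add_self_eq_zero (x (G.edge c))

/-- Between the two half-edges of `edge c`, the potential changes by the parity of the number of
half-edges of `e` passed, which is odd exactly when the edges interlace. Segments of `edge c` carry
no jump, so it is irrelevant at which end the walk arrives. -/
theorem IsPotential.single_side_ne_iff [Finite E] [DecidableEq E] (hG : G.IsConnectedBoundary)
    {c : C} {e : E} (hne : G.edge c ≠ e) {h : C → ZMod 2} (hh : G.IsPotential (Pi.single e 1) h) :
    h (G.side c) ≠ h c ↔ G.Interlaced (G.edge c) e := by
  have hseg : ∀ d, G.edge d = G.edge c → h (G.seg d) = h d := by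
    intro d hd
    rw [hh.2, hd, Pi.single_eq_of_ne hne, add_zero]
  constructor
  · intro hs
    have hpos := G.minimalPeriod_next_pos c
    obtain ⟨j, hj, hj0, hside⟩ := hG.exists_other_end hpos
    change G.next^[j] c = G.side c ∨ G.next^[j] c = G.seg (G.side c) at hside
    have hje : G.edge (G.next^[j] c) = G.edge c := by
      rcases hside with h | h <;> rw [h]
      · rw [G.edge_side]
      · rw [G.edge_seg_side]
    have hjs : h (G.next^[j] c) = h (G.side c) := by
      rcases hside with h1 | h1 <;> rw [h1]
      exact hseg _ (G.edge_side c)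
    have hit := hh.iterate_next c j
    rw [hjs] at hit
    obtain ⟨p, hp, hpe⟩ : ∃ p < j, G.edge (G.next^[p] c) = e := by
      by_contra! hall
      apply hs
      rw [hit, Finset.sum_eq_zero, add_zero]
      intro m hm
      exact Pi.single_eq_of_ne (hall m (Finset.mem_range.1 hm)) _
    obtain ⟨q, hq, hqp, hqs⟩ := hG.exists_other_end (hp.trans hj)
    have hqe : G.edge (G.next^[q] c) = e := by
      rcases hqs with h | h <;> rw [h]
      · rw [G.edge_side, hpe]
      · rw [G.edge_seg_side, hpe]
    have hp0 : p ≠ 0 := by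
      rintro rfl
      exact hne hpe
    have hqj : q ≠ j := by
      rintro rfl
      exact hne (hje.symm.trans hqe)
    refine ⟨c, p, j, q, by omega, hp, ?_, hq, rfl, hpe, hje, hqe⟩
    -- Otherwise both half-edges of `e` lie before `j` and their jumps cancel.
    by_contra hlt
    apply hs
    rw [hit, sum_single_edge, show Finset.filter _ _ = {p, q} from ?_, Finset.card_pair hqp.symm]
    · exact add_eq_left.2 rfl
    · ext m
      simp only [Finset.mem_filter, Finset.mem_range, Finset.mem_insert, Finset.mem_singleton]
      constructor
      · rintro ⟨hm, he⟩
        exact edge_iterate_next_eq_or (hp.trans hj) hq (hm.trans hj) hqp.symm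
          (hpe.trans hqe.symm) (hpe.trans he.symm)
      · rintro (rfl | rfl)
        · exact ⟨hp, hpe⟩
        · exact ⟨by omega, hqe⟩
  · rintro ⟨a, i, j, k, hi, hij, hjk, hk, h0, h1, h2, h3⟩
    have hsum : h (G.next^[j] a) = h a + 1 := by
      rw [hh.iterate_next, sum_single_edge, show Finset.filter _ _ = {i} from ?_,
        Finset.card_singleton, Nat.cast_one]
      ext m
      simp only [Finset.mem_filter, Finset.mem_range, Finset.mem_singleton]
      constructor
      · rintro ⟨hm, he⟩
        have := edge_iterate_next_eq_or (m := m) (i := i) (j := k) (by omega) hk (by omega)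
          (by omega) (h1.trans h3.symm) (h1.trans he.symm)
        omega
      · rintro rfl
        exact ⟨hij, h1⟩
    have hja : h (G.next^[j] a) = h (G.side a) := by
      rcases (G.edge_eq_iff a _).1 (h0.trans h2.symm) with h | h | h | h
      · have := iterate_next_unique (c := a) (i := j) (j := 0) (by omega) (by omega) (Or.inl h)
        omega
      · exact absurd h (G.iterate_next_ne_seg _ _)
      · rw [h]
      · rw [h, hseg _ (by rw [G.edge_side, h0])]
    intro hc
    have h4 := hh.side_eq_of_edge_eq h0
    rw [hc, CharTwo.add_self_eq_zero, ← hja, hsum, add_right_comm, CharTwo.add_self_eq_zero,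
      zero_add] at h4
    exact one_ne_zero h4

end Potential

end RibbonGraph

/-! ### Linear systems over `ZMod 2` attached to a signed graph -/

namespace SignedGraph

variable {V W : Type*}

open Classical in
/-- The adjacency matrix over `ZMod 2`, with diagonal entry `1` at the vertices of sign `-`. -/
noncomputable def coeff (S : SignedGraph V) (v w : V) : ZMod 2 :=
  if v = w then (if S.sign v = 1 then 0 else 1) else if S.graph.Adj v w then 1 else 0

/-- The linear map given by the matrix `S.coeff`. -/
noncomputable def boundary [Fintype V] (S : SignedGraph V) (x : V → ZMod 2) (v : V) : ZMod 2 :=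
  ∑ w, x w * S.coeff v w

/-- The vectors satisfying at each vertex `v` the linear equation selected by `t v`. -/
def solutions [Fintype V] (S : SignedGraph V) (t : V → Fin 3) : Set (V → ZMod 2) :=
  {x | ∀ v, ![x v, S.boundary x v, S.boundary x v + x v] (t v) = 0}

theorem coeff_iso {S : SignedGraph V} {T : SignedGraph W} (φ : S.graph ≃g T.graph)
    (hφ : ∀ v, T.sign (φ v) = S.sign v) (v w : V) : T.coeff (φ v) (φ w) = S.coeff v w := by
  have hadj : T.graph.Adj (φ v) (φ w) ↔ S.graph.Adj v w := φ.map_rel_iff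
  have heq : φ v = φ w ↔ v = w := φ.injective.eq_iff
  unfold coeff
  by_cases h : v = w
  · rw [if_pos h, if_pos (heq.2 h), hφ]
  · rw [if_neg h, if_neg (heq.not.2 h)]
    by_cases h' : S.graph.Adj v w
    · rw [if_pos h', if_pos (hadj.2 h')]
    · rw [if_neg h', if_neg (hadj.not.2 h')]

theorem card_solutions_iso [Fintype V] [Fintype W] {S : SignedGraph V} {T : SignedGraph W}
    (φ : S.graph ≃g T.graph) (hφ : ∀ v, T.sign (φ v) = S.sign v) (t : W → Fin 3) :
    Nat.card (S.solutions fun v => t (φ v)) = Nat.card (T.solutions t) := by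
  have hb : ∀ (x : W → ZMod 2) v, S.boundary (fun w => x (φ w)) v = T.boundary x (φ v) := by
    intro x v
    unfold boundary
    rw [← φ.toEquiv.sum_comp]
    exact Finset.sum_congr rfl fun w _ => by rw [← coeff_iso φ hφ]; rfl
  refine (Nat.card_congr ((Equiv.arrowCongr φ.toEquiv.symm (Equiv.refl _)).subtypeEquiv ?_)).symm
  intro x
  change (∀ w, _) ↔ ∀ v, _
  rw [← φ.toEquiv.forall_congr_right]
  refine forall_congr' fun v => ?_
  have h := hb x v
  simp only [Equiv.arrowCongr, Equiv.coe_fn_mk, Function.comp_def,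
    Equiv.symm_symm, Equiv.coe_refl, id] at h ⊢
  rw [show S.boundary (fun w => x (φ.toEquiv w)) v = _ from h]
  rfl

end SignedGraph

/-! ### Counting the vertices of a repaired bouquet -/

namespace RibbonGraph

variable {E C : Type*} {G : RibbonGraph E C}

/-- The three ways of pairing the corners of each edge. -/
def pairing (G : RibbonGraph E C) : Fin 3 → C → C :=
  ![G.seg, G.side, fun c => G.seg (G.side c)]

/-- `H` has the arcs of `G`, and the line segments of `H` pair the corners of each edge `e` of `G`
in the way `t e`. -/
structure IsRepairing (G H : RibbonGraph E C) (t : E → Fin 3) : Prop where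
  arc : H.arc = G.arc
  isolated : H.isolated = G.isolated
  seg : ∀ c, H.seg c = G.pairing (t (G.edge c)) c

theorem zmod_two_add_eq_one_of_ne {a b : ZMod 2} (h : a ≠ b) : a + b = 1 := by
  revert a b
  decide

/-- Superpose the single-edge potentials: their changes along free sides are the matrix entries,
diagonal ones by orientability and off-diagonal ones by interlacement. -/
theorem IsConnectedBoundary.exists_potential [Fintype E] (hG : G.IsConnectedBoundary)
    (x : E → ZMod 2) : ∃ f, G.IsPotential x f ∧
      ∀ c, f (G.side c) + f c = G.signedIntersectionGraph.boundary x (G.edge c) := by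
  classical
  choose h hh using fun e => hG.exists_potential_single e
  refine ⟨fun c => ∑ e, x e * h e c, ?_, fun c => ?_⟩
  · convert IsPotential.sum Finset.univ x hh using 1
    ext e
    simp [Pi.single_apply]
  · rw [← Finset.sum_add_distrib]
    refine Finset.sum_congr rfl fun e _ => ?_
    rw [← mul_add]
    congr 1
    unfold SignedGraph.coeff
    by_cases he : G.edge c = e
    · subst he
      have key := (hh (G.edge c)).single_side_eq_iff hG
      by_cases ho : G.IsOrientableLoop (G.edge c)
      · simp [signedIntersectionGraph, ho, CharTwo.add_eq_zero, key]
      · simpa [signedIntersectionGraph, ho] using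
          zmod_two_add_eq_one_of_ne (fun h' => ho (key.1 h'))
    · have key := (hh e).single_side_ne_iff hG he
      have hadj : G.signedIntersectionGraph.graph.Adj (G.edge c) e ↔
          G.Interlaced (G.edge c) e := and_iff_right he
      by_cases hi : G.Interlaced (G.edge c) e
      · rw [if_neg he, if_pos (hadj.2 hi)]
        exact zmod_two_add_eq_one_of_ne (key.2 hi)
      · rw [if_neg he, if_neg (hi ∘ hadj.1), CharTwo.add_eq_zero]
        exact not_not.1 (hi ∘ key.1)

theorem IsPotential.side_add [Fintype E] (hG : G.IsConnectedBoundary) {x : E → ZMod 2}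
    {f : C → ZMod 2} (hf : G.IsPotential x f) (c : C) :
    f (G.side c) + f c = G.signedIntersectionGraph.boundary x (G.edge c) := by
  obtain ⟨k, hk, hkb⟩ := hG.exists_potential x
  rw [← hkb]
  have h := hf.eq_of_eq hG hk c (G.side c)
  linear_combination h + CharTwo.add_self_eq_zero (f c) - CharTwo.add_self_eq_zero (k (G.side c))

theorem IsRepairing.invariant_iff [Fintype E] (hG : G.IsConnectedBoundary) {H : RibbonGraph E C}
    {t : E → Fin 3} (hH : G.IsRepairing H t) {x : E → ZMod 2} {f : C → ZMod 2}
    (hf : G.IsPotential x f) :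
    (∀ c, f (H.seg c) = f c) ↔ x ∈ G.signedIntersectionGraph.solutions t := by
  have key : ∀ c, f (H.seg c) = f c ↔
      ![x (G.edge c), G.signedIntersectionGraph.boundary x (G.edge c),
        G.signedIntersectionGraph.boundary x (G.edge c) + x (G.edge c)] (t (G.edge c)) = 0 := by
    intro c
    rw [hH.seg, ← hf.side_add hG c]
    generalize t (G.edge c) = k
    fin_cases k
    · simp [pairing, hf.2]
    · simp [pairing, CharTwo.add_eq_zero]
    · simp only [pairing, Fin.reduceFinMk, Matrix.cons_val, hf.2, G.edge_side]
      rw [add_right_comm, CharTwo.add_eq_zero]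
  exact (forall_congr' key).trans (G.edge_surjective.forall (p := fun e =>
    ![x e, G.signedIntersectionGraph.boundary x e,
      G.signedIntersectionGraph.boundary x e + x e] (t e) = 0)).symm

/-- What matters is that `f` jumps equally along both segments of an edge. For pairing `0` both
jumps vanish; for the other two, `H.seg` carries one segment onto the other and preserves `f`. -/
theorem IsRepairing.exists_potential {H : RibbonGraph E C} {t : E → Fin 3}
    (hH : G.IsRepairing H t) {f : C → ZMod 2} (ha : ∀ c, f (G.arc c) = f c)
    (hs : ∀ c, f (H.seg c) = f c) : ∃ x, G.IsPotential x f := by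
  have hseg : ∀ c d, G.edge c = G.edge d → f (G.seg c) + f c = f (G.seg d) + f d := by
    have hside : ∀ c, f (G.seg (G.side c)) + f (G.side c) = f (G.seg c) + f c := by
      intro c
      have h1 := hs c
      have h2 := hs (G.seg c)
      have h3 := hs (G.side c)
      rw [hH.seg] at h1 h2 h3
      rw [G.edge_seg] at h2
      rw [G.edge_side] at h3
      generalize t (G.edge c) = k at h1 h2 h3
      fin_cases k
      · simp only [pairing, Fin.zero_eta, Matrix.cons_val] at h1 h2 h3
        rw [h1, h3, CharTwo.add_self_eq_zero, CharTwo.add_self_eq_zero]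
      · simp only [pairing, Fin.mk_one, Matrix.cons_val] at h1 h2 h3
        rw [h1, G.seg_side_comm, h2]
      · simp only [pairing, Fin.reduceFinMk, Matrix.cons_val] at h1 h2 h3
        rw [← G.seg_side_comm, G.seg_involutive] at h2
        rw [h1, h2, add_comm]
    intro c d hcd
    rcases (G.edge_eq_iff c d).1 hcd with rfl | rfl | rfl | rfl
    · rfl
    · rw [G.seg_involutive, add_comm]
    · exact (hside c).symm
    · rw [G.seg_involutive, add_comm (f (G.side c)), hside]
  choose r hr using G.edge_surjective
  refine ⟨fun e => f (G.seg (r e)) + f (r e), ha, fun c => ?_⟩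
  change f (G.seg c) = f c + (f (G.seg (r (G.edge c))) + f (r (G.edge c)))
  rw [hseg _ c (hr _)]
  linear_combination -CharTwo.add_self_eq_zero (f c)

/-- The functions on the corners that are constant on each vertex boundary. -/
def boundaryFunctions (G : RibbonGraph E C) : Set (C → ZMod 2) :=
  {f | (∀ c, f (G.arc c) = f c) ∧ ∀ c, f (G.seg c) = f c}

theorem card_boundaryFunctions [Finite C] (G : RibbonGraph E C) :
    Nat.card G.boundaryFunctions =
      2 ^ Nat.card (Quot fun c d : C => d = G.seg c ∨ d = G.arc c) := by
  have e : ((Quot fun c d : C => d = G.seg c ∨ d = G.arc c) → ZMod 2) ≃ G.boundaryFunctions :=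
    { toFun := fun g => ⟨fun c => g (Quot.mk _ c),
        fun c => congrArg g (Quot.sound (r := fun c d : C => d = G.seg c ∨ d = G.arc c)
          (Or.inr rfl)).symm,
        fun c => congrArg g (Quot.sound (r := fun c d : C => d = G.seg c ∨ d = G.arc c)
          (Or.inl rfl)).symm⟩
      invFun := fun f => Quot.lift f.1 (by
        rintro a b (rfl | rfl)
        · exact (f.2.2 a).symm
        · exact (f.2.1 a).symm)
      left_inv := fun g => by
        ext q
        induction q using Quot.ind
        rfl
      right_inv := fun f => rfl }
  rw [← Nat.card_congr e, Nat.card_fun, Nat.card_zmod]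

/-- An invariant function corresponds to its jump vector together with its value at one corner; the
latter gives the factor `2`. -/
theorem IsRepairing.card_boundaryFunctions [Fintype E] [Nonempty C] (hG : G.IsConnectedBoundary)
    {H : RibbonGraph E C} {t : E → Fin 3} (hH : G.IsRepairing H t) :
    Nat.card H.boundaryFunctions = 2 * Nat.card (G.signedIntersectionGraph.solutions t) := by
  obtain ⟨c⟩ := ‹Nonempty C›
  have harc : ∀ f : C → ZMod 2, (∀ c, f (H.arc c) = f c) ↔ ∀ c, f (G.arc c) = f c := by
    rw [hH.arc]
    exact fun _ => Iff.rfl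
  choose x hx using fun f : H.boundaryFunctions => hH.exists_potential ((harc f).1 f.2.1) f.2.2
  let Ψ : H.boundaryFunctions → ZMod 2 × G.signedIntersectionGraph.solutions t :=
    fun f => (f.1 c, ⟨x f, (hH.invariant_iff hG (hx f)).1 f.2.2⟩)
  have hΨ : Function.Bijective Ψ := by
    constructor
    · intro f g hfg
      obtain ⟨h1, h2⟩ := Prod.ext_iff.1 hfg
      have h2' : x f = x g := Subtype.ext_iff.1 h2
      have h1' : f.1 c = g.1 c := h1
      ext d
      have h := (hx f).eq_of_eq hG (h2' ▸ hx g) c d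
      rw [h1', CharTwo.add_self_eq_zero, CharTwo.add_eq_zero] at h
      exact h
    · rintro ⟨a, y, hy⟩
      obtain ⟨k, hk, -⟩ := hG.exists_potential y
      -- The constant `k c + a` makes the value at `c` equal to `a`.
      have hf : G.IsPotential y fun d => k d + (k c + a) :=
        ⟨fun d => by simp only [hk.1], fun d => by simp only [hk.2]; ring⟩
      let f : H.boundaryFunctions :=
        ⟨fun d => k d + (k c + a), (harc fun d => k d + (k c + a)).2 hf.1, (hH.invariant_iff hG hf).2 hy⟩
      refine ⟨f, Prod.ext ?_ (Subtype.ext ?_)⟩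
      · change k c + (k c + a) = a
        rw [← add_assoc, CharTwo.add_self_eq_zero, zero_add]
      · funext e
        obtain ⟨d, rfl⟩ := G.edge_surjective e
        exact add_left_cancel (((hx f).2 d).symm.trans (hf.2 d))
  rw [Nat.card_eq_of_bijective Ψ hΨ, Nat.card_prod, Nat.card_zmod]

theorem IsBouquet.two_pow_vertexCount [Fintype E] (hG : G.IsBouquet) {H : RibbonGraph E C}
    {t : E → Fin 3} (hH : G.IsRepairing H t) :
    2 ^ H.vertexCount = 2 * Nat.card (G.signedIntersectionGraph.solutions t) := by
  have := G.finite_corners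
  unfold IsBouquet vertexCount at hG
  cases isEmpty_or_nonempty C
  -- Without edges the only vertex is isolated and the empty vector is the only solution.
  · have : IsEmpty E := ⟨fun e => isEmptyElim (G.edge_surjective e).choose⟩
    have hsol : G.signedIntersectionGraph.solutions t = Set.univ :=
      Set.eq_univ_of_forall fun x v => isEmptyElim v
    have hempty : ∀ r : C → C → Prop, Nat.card (Quot r) = 0 := fun r =>
      have : IsEmpty (Quot r) := ⟨fun q => isEmptyElim q.exists_rep.choose⟩
      Nat.card_of_isEmpty
    rw [hempty, zero_add] at hG
    rw [vertexCount, hempty, hH.isolated, hG, hsol]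
    simp
  · have : Nonempty (Quot fun c d : C => d = G.seg c ∨ d = G.arc c) :=
      ‹Nonempty C›.map (Quot.mk _)
    have hpos : 0 < Nat.card (Quot fun c d : C => d = G.seg c ∨ d = G.arc c) := Nat.card_pos
    have hconn : G.IsConnectedBoundary :=
      (Nat.card_eq_one_iff_unique.1 (by omega)).1
    rw [vertexCount, hH.isolated, show G.isolated = 0 by omega, add_zero,
      ← RibbonGraph.card_boundaryFunctions, hH.card_boundaryFunctions hconn]

theorem IsBouquet.vertexCount_eq_of_iso {E' C' : Type*} [Fintype E] [Fintype E']
    {G' : RibbonGraph E' C'} (hG : G.IsBouquet) (hG' : G'.IsBouquet)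
    (φ : G.signedIntersectionGraph.graph ≃g G'.signedIntersectionGraph.graph)
    (hφ : ∀ v, G'.signedIntersectionGraph.sign (φ v) = G.signedIntersectionGraph.sign v)
    {H : RibbonGraph E C} {H' : RibbonGraph E' C'} {t : E → Fin 3} {t' : E' → Fin 3}
    (hH : G.IsRepairing H t) (hH' : G'.IsRepairing H' t') (ht : ∀ e, t e = t' (φ e)) :
    H.vertexCount = H'.vertexCount := by
  obtain rfl : t = fun e => t' (φ e) := funext ht
  apply Nat.pow_right_injective le_rfl
  simp only [hG.two_pow_vertexCount hH, hG'.two_pow_vertexCount hH',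
    SignedGraph.card_solutions_iso φ hφ]

/-! ### The pairings produced by the operations -/

open RibbonOp

open Classical in
theorem isRepairing_delta (G : RibbonGraph E C) (A : Set E) :
    G.IsRepairing (G.act [delta] A) (fun e => if e ∈ A then 1 else 0) := by
  refine ⟨rfl, rfl, fun c => ?_⟩
  by_cases h : G.edge c ∈ A <;> simp [act, applyOp, partialDual, pairing, h]

open Classical in
theorem isRepairing_tauDeltaTau (G : RibbonGraph E C) (A : Set E) :
    G.IsRepairing (G.act [tau, delta, tau] A) (fun e => if e ∈ A then 2 else 0) := by
  refine ⟨rfl, rfl, fun c => ?_⟩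
  by_cases h : G.edge c ∈ A <;>
    simp [act, applyOp, partialDual, partialPetrial, pairing, h]

theorem isRepairing_deltaTau (G : RibbonGraph E C) (p : E → Fin 3) :
    G.IsRepairing (((G.act [] (p ⁻¹' {0})).act [tau, delta] (p ⁻¹' {1})).act
      [delta, tau] (p ⁻¹' {2})) p := by
  refine ⟨rfl, rfl, fun c => ?_⟩
  obtain ⟨k, hk⟩ : ∃ k, p (G.edge c) = k := ⟨_, rfl⟩
  fin_cases k <;> simp at hk <;>
    simp [act, applyOp, partialDual, partialPetrial, pairing, hk, G.edge_side]

/-- A half-twist leaves `seg` alone, so a final `τ` does not affect the vertices: `1` and `τ` give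
pairing `0`, `δ` and `τδ` give `1`, `δτ` and `τδτ` give `2`. -/
theorem isRepairing_full (G : RibbonGraph E C) (p : E → Fin 6) :
    G.IsRepairing ((((((G.act [] (p ⁻¹' {0})).act [delta] (p ⁻¹' {1})).act [tau] (p ⁻¹' {2})).act
      [tau, delta] (p ⁻¹' {3})).act [delta, tau] (p ⁻¹' {4})).act
      [tau, delta, tau] (p ⁻¹' {5})) (fun e => ![0, 1, 0, 1, 2, 2] (p e)) := by
  refine ⟨rfl, rfl, fun c => ?_⟩
  obtain ⟨k, hk⟩ : ∃ k, p (G.edge c) = k := ⟨_, rfl⟩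
  fin_cases k <;> simp at hk <;>
    simp [act, applyOp, partialDual, partialPetrial, pairing, hk, G.edge_side]

end RibbonGraph

/-! ### Reindexing the sums along the isomorphism -/

open RibbonGraph

theorem theorem3 {E₁ C₁ E₂ C₂ : Type*} [Fintype E₁] [DecidableEq E₁] [Fintype E₂] [DecidableEq E₂]
    (B₁ : RibbonGraph E₁ C₁) (B₂ : RibbonGraph E₂ C₂)
    (hB₁ : B₁.IsBouquet) (hB₂ : B₂.IsBouquet)
    (hSI : B₁.signedIntersectionGraph.IsIsomorphic B₂.signedIntersectionGraph) :
    B₁.vertexPolyDelta = B₂.vertexPolyDelta ∧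
      B₁.vertexPolyDeltaTau = B₂.vertexPolyDeltaTau ∧
      B₁.vertexPolyTauDeltaTau = B₂.vertexPolyTauDeltaTau ∧
      B₁.vertexPolyFull = B₂.vertexPolyFull := by
  obtain ⟨φ, hφ⟩ := hSI
  refine ⟨?_, ?_, ?_, ?_⟩
  · refine Fintype.sum_equiv φ.toEquiv.finsetCongr _ _ fun A => ?_
    rw [hB₁.vertexCount_eq_of_iso hB₂ φ hφ (B₁.isRepairing_delta _) (B₂.isRepairing_delta _)]
    intro e
    simp
  · refine Fintype.sum_equiv (φ.toEquiv.arrowCongr (Equiv.refl _)) _ _ fun p => ?_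
    rw [hB₁.vertexCount_eq_of_iso hB₂ φ hφ (B₁.isRepairing_deltaTau _)
      (B₂.isRepairing_deltaTau _)]
    intro e
    exact congrArg p (φ.symm_apply_apply e).symm
  · refine Fintype.sum_equiv φ.toEquiv.finsetCongr _ _ fun A => ?_
    rw [hB₁.vertexCount_eq_of_iso hB₂ φ hφ (B₁.isRepairing_tauDeltaTau _)
      (B₂.isRepairing_tauDeltaTau _)]
    intro e
    simp
  · refine Fintype.sum_equiv (φ.toEquiv.arrowCongr (Equiv.refl _)) _ _ fun p => ?_
    rw [hB₁.vertexCount_eq_of_iso hB₂ φ hφ (B₁.isRepairing_full _) (B₂.isRepairing_full _)]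
    intro e
    exact congrArg (fun e => ![0, 1, 0, 1, 2, 2] (p e)) (φ.symm_apply_apply e).symm
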